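/- **Setting.** Let $m,n\ge 3$ be odd integers. The $m\times n$ projective grid graph $\mathcal P_{m,n}$ has vertices $(i,j)$, $1\le i\le m$, $1\le j\le n$, and edges joining $(i,j)$ to $(i,j+1)$ for $1\le i\le m$, $1\le j<n$; $(i,j)$ to $(i+1,j)$ for $1\le i<m$, $1\le j\le n$; $(i,n)$ to $(m+1-i,1)$ for $1\le i\le m$; and $(m,j)$ to $(1,n+1-j)$ for $1\le j\le n$. It is embedded naturally in the projective plane. Its faces are the two digons $\{(1,1),(m,n)\}$ and $\{(m,1),(1,n)\}$ and the following 4-cycles ($1\le i<m$, $1\le j<n$): $(i,j),(i,j+1),(i+1,j+1),(i+1,j)$; $(i,n),(m+1-i,1),(m-i,1),(i+1,n)$; and $(m,j),(1,n+1-j),(1,n-j),(m,j+1)$. A *$C_4$-face-magic projective labeling* on $\mathcal P_{m,n}$ with value $S$ is a bijection $(i,j)\mapsto x_{i,j}$ from the vertices onto $\{1,\dots,mn\}$ such that the labels around each 4-cycle face sum to $S$. It is *bicentrally balanced* if $S=2mn+3$ and, for all vertices $(i,j)$, $x_{i,j}+x_{m+1-i,n+1-j}$ equals $\frac12mn+\frac32$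 if $i+j$ is even and $\frac32mn+\frac32$ if $i+j$ is odd. With $m_0^+=\frac{m+1}2$ and $n_0^+=\frac{n+1}2$, it is moreover *standard* if, for $1\le i\le m-2$, $x_{i,n_0^+}<x_{i+2,n_0^+}$ when $i+n_0^+$ is even and $x_{i,n_0^+}>x_{i+2,n_0^+}$ when $i+n_0^+$ is odd, and, for $1\le j\le n-2$, $x_{m_0^+,j}<x_{m_0^+,j+2}$ when $m_0^++j$ is even and $x_{m_0^+,j}>x_{m_0^+,j+2}$ when $m_0^++j$ is odd. An *$(m,n)$-projective factorization sequence* is a sequence of pairs $F=((m_1,n_1),\dots,(m_k,n_k))$, $k\ge1$, with $m=m_1\cdots m_k$, $n=n_1\cdots n_k$ and all entries greater than $1$, except that $n_k=1$ is also allowed when $k\ge 2$. **Base labelings.** Let $a,b\ge3$ be odd, $a_0=\frac{a-1}2$, $a_0^+=\frac{a+1}2$, $b_0=\frac{b-1}2$, $b_0^+=\frac{b+1}2$. The labeling $x=\mathrm{HALL}(a,b)$ of the $a\times b$ grid $\{1,\dots,a\}\times\{1,\dots,b\}$ is - $x_{2i-1,2j-1}=a(j-1)+i$ for $1\le i\le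 a_0^+$, $1\le j\le b_0^+$; - $x_{2i,2j}=a(j-1)+a_0^++i$ for $1\le i\le a_0$, $1\le j\le b_0$; - $x_{2i,2j-1}=mn+a(1-j)+1-i$ for $1\le i\le a_0$, $1\le j\le b_0^+$; - $x_{2i-1,2j}=mn-aj+a_0^++1-i$ for $1\le i\le a_0^+$, $1\le j\le b_0$. In the same ranges of $i$ and $j$, $y=\mathrm{VALL}(a,b)$ is $y_{2i-1,2j-1}=b(i-1)+j$, $y_{2i,2j}=b(i-1)+b_0^++j$, $y_{2i,2j-1}=mn-bi+b_0^++1-j$, $y_{2i-1,2j}=mn+b(1-i)+1-j$. **Alternating connected sums.** Let $X=(x_{i,j})$ be a labeling of the $a\times b$ grid ($a,b$ odd) and let $r=2r_0+1$ be an odd positive integer. The $r$-horizontal alternating connected sum $\mathrm{HASC}^r(X)=(y_{i,j})$ is the labeling of the $ar\times b$ grid given, for $1\le i\le a$ and $1\le j\le b$, by - $y_{(2k-1)a+i,j}=mn-x_{i,j}+\varepsilon(k-\frac12)ab+\frac32$ for $1\le k\le r_0$, - $y_{2ka+i,j}=x_{i,j}-\varepsilon kab$ for $0\le k\le r_0$,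 where $\varepsilon=1$ if $i+j$ is odd and $\varepsilon=-1$ if $i+j$ is even. The $r$-vertical alternating connected sum $\mathrm{VASC}^r(X)$ is the labeling of the $a\times br$ grid given by the same right-hand sides for $y_{i,(2k-1)b+j}$ and $y_{i,2kb+j}$. **Constructions.** For an $(m,n)$-projective factorization sequence $F=((m_i,n_i))_{i=1}^k$ let $X_1=\mathrm{HALL}(m_1,n_1)$, let $X_i=\mathrm{VASC}^{n_i}(\mathrm{HASC}^{m_i}(X_{i-1}))$ for $2\le i\le k$, and let $\mathrm{HBBL}(F)=X_k$. For an $(n,m)$-projective factorization sequence $F'=((n'_i,m'_i))_{i=1}^{k}$ let $X'_1=\mathrm{VALL}(m'_1,n'_1)$, let $X'_i=\mathrm{HASC}^{m'_i}(\mathrm{VASC}^{n'_i}(X'_{i-1}))$ for $2\le i\le k$, and let $\mathrm{VBBL}(F')=X'_k$. **Theorem.** Let $m,n\ge3$ be odd integers. 1. For every $(m,n)$-projective factorization sequence $F$, $\mathrm{HBBL}(F)$ is a standard bicentrally balanced $C_4$-face-magic projective labeling on $\mathcal P_{m,n}$. 2. For every $(n,m)$-projective factorization sequence $F'$, $\mathrm{VBBL}(F')$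 is a standard bicentrally balanced $C_4$-face-magic projective labeling on $\mathcal P_{m,n}$. 3. If $F_1\ne F_2$ are $(m,n)$-projective factorization sequences, then $\mathrm{HBBL}(F_1)\ne\mathrm{HBBL}(F_2)$ as labelings on $\mathcal P_{m,n}$. 4. If $F_1'\ne F_2'$ are $(n,m)$-projective factorization sequences, then $\mathrm{VBBL}(F_1')\ne\mathrm{VBBL}(F_2')$ as labelings on $\mathcal P_{m,n}$. -/

import Mathlib

/-! Vertices and faces of the projective grid graph. -/

/-- The vertex set of the `m × n` projective grid graph, `{(i, j) : 1 ≤ i ≤ m, 1 ≤ j ≤ n}`. -/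
def projGridVertices (m n : ℕ) : Set (ℕ × ℕ) :=
  {v | 1 ≤ v.1 ∧ v.1 ≤ m ∧ 1 ≤ v.2 ∧ v.2 ≤ n}

/-- The faces of the `m × n` projective grid graph in its natural embedding in the projective
plane, each given by the list of the vertices along its boundary. The edges of the graph join
`(i, j)` to `(i, j + 1)`, `(i, j)` to `(i + 1, j)`, `(i, n)` to `(m + 1 - i, 1)` and `(m, j)` to
`(1, n + 1 - j)`. There are `(m - 1) (n - 1)` inner faces, `m - 1` and `n - 1` faces that cross
the two pairs of identified sides, and the two digons at the corners. -/
inductive IsProjGridFace (m n : ℕ) : List (ℕ × ℕ) → Prop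
  | inner (i j : ℕ) (hi : 1 ≤ i) (hi' : i < m) (hj : 1 ≤ j) (hj' : j < n) :
      IsProjGridFace m n [(i, j), (i, j + 1), (i + 1, j + 1), (i + 1, j)]
  | crossTop (i : ℕ) (hi : 1 ≤ i) (hi' : i < m) :
      IsProjGridFace m n [(i, n), (m + 1 - i, 1), (m - i, 1), (i + 1, n)]
  | crossRight (j : ℕ) (hj : 1 ≤ j) (hj' : j < n) :
      IsProjGridFace m n [(m, j), (1, n + 1 - j), (1, n - j), (m, j + 1)]
  | digonOne : IsProjGridFace m n [(1, 1), (m, n)]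
  | digonTwo : IsProjGridFace m n [(m, 1), (1, n)]

/-! Labelings. -/

/-- A labeling of the grid `{(i, j) : 1 ≤ i ≤ width, 1 ≤ j ≤ height}` by integers. Only the
values of `label` at the points of this grid are relevant. -/
structure GridLabeling where
  width : ℕ
  height : ℕ
  label : ℕ × ℕ → ℤ

/-- `X` is a `C₄`-face-magic projective labeling on the `m × n` projective grid graph with
`C₄`-face-magic value `S`: it labels the vertices bijectively by `1, …, m n`, and the sum of the
labels around every face that is a 4-cycle equals `S`. -/
structure IsC4FaceMagicLabeling (m n : ℕ) (S : ℤ) (X : GridLabeling) : Prop where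
  width_eq : X.width = m
  height_eq : X.height = n
  bijOn : Set.BijOn X.label (projGridVertices m n) (Set.Icc 1 ((m : ℤ) * n))
  face_sum : ∀ f : List (ℕ × ℕ), IsProjGridFace m n f → f.length = 4 → (f.map X.label).sum = S

/-- A `C₄`-face-magic projective labeling is bicentrally balanced if its value is `2 m n + 3` and
`x (i, j) + x (m + 1 - i, n + 1 - j)` is `m n / 2 + 3 / 2` when `i + j` is even and
`3 m n / 2 + 3 / 2` when `i + j` is odd (the equation is multiplied by `2` here). -/
structure IsBicentrallyBalanced (m n : ℕ) (X : GridLabeling) : Prop where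
  magic : IsC4FaceMagicLabeling m n (2 * m * n + 3) X
  balanced : ∀ i j : ℕ, (i, j) ∈ projGridVertices m n →
    2 * (X.label (i, j) + X.label (m + 1 - i, n + 1 - j)) =
      if Even (i + j) then (m : ℤ) * n + 3 else 3 * ((m : ℤ) * n) + 3

/-- Standard bicentrally balanced labelings (`m` and `n` odd): the labels in the central row
`j = (n + 1) / 2` and in the central column `i = (m + 1) / 2` increase in steps of two at the
vertices with even coordinate sum, and decrease in steps of two at those with odd coordinate
sum. -/
structure IsStandardBicentrallyBalanced (m n : ℕ) (X : GridLabeling) : Prop where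
  balanced : IsBicentrallyBalanced m n X
  row_even : ∀ i : ℕ, 1 ≤ i → i + 2 ≤ m → Even (i + (n + 1) / 2) →
    X.label (i, (n + 1) / 2) < X.label (i + 2, (n + 1) / 2)
  row_odd : ∀ i : ℕ, 1 ≤ i → i + 2 ≤ m → Odd (i + (n + 1) / 2) →
    X.label (i + 2, (n + 1) / 2) < X.label (i, (n + 1) / 2)
  col_even : ∀ j : ℕ, 1 ≤ j → j + 2 ≤ n → Even ((m + 1) / 2 + j) →
    X.label ((m + 1) / 2, j) < X.label ((m + 1) / 2, j + 2)
  col_odd : ∀ j : ℕ, 1 ≤ j → j + 2 ≤ n → Odd ((m + 1) / 2 + j) →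
    X.label ((m + 1) / 2, j + 2) < X.label ((m + 1) / 2, j)

/-! Alternating lexicographic labelings. -/

/-- The partial horizontal alternating lexicographic labeling on the `m × n` subgrid of the
`M × N` projective grid graph (`m`, `n` odd). At `v = (2 i - 1 or 2 i, 2 j - 1 or 2 j)` the
variables `i` and `j` below have these values. -/
def HALL (M N m n : ℕ) : GridLabeling where
  width := m
  height := n
  label v :=
    let i : ℤ := ((v.1 + 1) / 2 : ℕ)
    let j : ℤ := ((v.2 + 1) / 2 : ℕ)
    let m₀' : ℤ := ((m + 1) / 2 : ℕ)
    if Odd v.1 then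
      if Odd v.2 then m * (j - 1) + i
      else M * N - m * j + m₀' + 1 - i
    else
      if Odd v.2 then M * N + m * (1 - j) + 1 - i
      else m * (j - 1) + m₀' + i

/-- The partial vertical alternating lexicographic labeling on the `m × n` subgrid of the
`M × N` projective grid graph (`m`, `n` odd), with `i` and `j` as in `HALL`. -/
def VALL (M N m n : ℕ) : GridLabeling where
  width := m
  height := n
  label v :=
    let i : ℤ := ((v.1 + 1) / 2 : ℕ)
    let j : ℤ := ((v.2 + 1) / 2 : ℕ)
    let n₀' : ℤ := ((n + 1) / 2 : ℕ)
    if Odd v.1 then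
      if Odd v.2 then n * (i - 1) + j
      else M * N + n * (1 - i) + 1 - j
    else
      if Odd v.2 then M * N - n * i + n₀' + 1 - j
      else n * (i - 1) + n₀' + j

/-! Alternating connected sums. -/

/-- The label which the `q`-th block (counted from `0`) of an alternating connected sum of a
labeling of an `m × n` grid carries at a vertex that has the position `(i, j)` in its block, where
`x` is the label of `(i, j)` in the labeling that is summed.
* If `q = 2 k - 1`, it is `M N - x + (k - 1 / 2) m n + 3 / 2` for `i + j` odd and
  `M N - x - (k - 1 / 2) m n + 3 / 2` for `i + j` even.
* If `q = 2 k`, it is `x - k m n` for `i + j` odd and `x + k m n` for `i + j` even.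

The integer divisions by `2` are exact as `m` and `n` are odd. -/
def alternatingLabel (M N m n q i j : ℕ) (x : ℤ) : ℤ :=
  let k : ℤ := ((q + 1) / 2 : ℕ)
  if Odd q then
    if Odd (i + j) then M * N - x + ((2 * k - 1) * (m * n) + 3) / 2
    else M * N - x + (-((2 * k - 1) * (m * n)) + 3) / 2
  else
    if Odd (i + j) then x - k * (m * n)
    else x + k * (m * n)

/-- The `r`-horizontal alternating connected sum inside the `M × N` projective grid graph. The
vertex `(q m + i, j)` with `1 ≤ i ≤ m` has the position `(i, j)` in block `q`. -/
def HASC (M N r : ℕ) (X : GridLabeling) : GridLabeling where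
  width := X.width * r
  height := X.height
  label v :=
    let q := (v.1 - 1) / X.width
    let i := (v.1 - 1) % X.width + 1
    alternatingLabel M N X.width X.height q i v.2 (X.label (i, v.2))

/-- The `r`-vertical alternating connected sum inside the `M × N` projective grid graph. The
vertex `(i, q n + j)` with `1 ≤ j ≤ n` has the position `(i, j)` in block `q`. -/
def VASC (M N r : ℕ) (X : GridLabeling) : GridLabeling where
  width := X.width
  height := X.height * r
  label v :=
    let q := (v.2 - 1) / X.height
    let j := (v.2 - 1) % X.height + 1
    alternatingLabel M N X.width X.height q v.1 j (X.label (v.1, j))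

/-! Projective factorization sequences and the labelings associated with them. -/

/-- `(m, n)`-projective factorization sequences, as lists of pairs `(m₁, n₁), …, (mₖ, nₖ)` with
`m = m₁ ⋯ mₖ` and `n = n₁ ⋯ nₖ`. In a sequence of even length all entries are greater than `1`.
A sequence of odd length `(m₁, n₁, …, mₖ, nₖ, mₖ₊₁)`, where `k ≥ 1`, is represented with
`nₖ₊₁ = 1` appended. -/
def IsProjFactorizationSeq (m n : ℕ) (F : List (ℕ × ℕ)) : Prop :=
  (F.map Prod.fst).prod = m ∧ (F.map Prod.snd).prod = n ∧
    ((F ≠ [] ∧ ∀ p ∈ F, 1 < p.1 ∧ 1 < p.2) ∨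
      ∃ (G : List (ℕ × ℕ)) (a : ℕ), G ≠ [] ∧ (∀ p ∈ G, 1 < p.1 ∧ 1 < p.2) ∧ 1 < a ∧
        F = G ++ [(a, 1)])

/-- The horizontal bicentrally balanced labeling associated with the sequence
`F = ((m₁, n₁), …, (mₖ, nₖ))`: it is `Xₖ`, where `X₁ = HALL (m₁, n₁)` and `Xᵢ` is the
`nᵢ`-vertical alternating connected sum of the `mᵢ`-horizontal one of `Xᵢ₋₁`. The value at the
empty list, which is no factorization sequence, is irrelevant. -/
def HBBL (m n : ℕ) : List (ℕ × ℕ) → GridLabeling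
  | [] => ⟨0, 0, fun _ => 0⟩
  | p :: F => F.foldl (fun X p => VASC m n p.2 (HASC m n p.1 X)) (HALL m n p.1 p.2)

/-- The vertical bicentrally balanced labeling associated with an `(n, m)`-sequence
`F' = ((n₁, m₁), …, (nₖ, mₖ))`: it is `Xₖ`, where `X₁ = VALL (m₁, n₁)` and `Xᵢ` is the
`mᵢ`-horizontal alternating connected sum of the `nᵢ`-vertical one of `Xᵢ₋₁`. The value at the
empty list, which is no factorization sequence, is irrelevant. -/
def VBBL (m n : ℕ) : List (ℕ × ℕ) → GridLabeling
  | [] => ⟨0, 0, fun _ => 0⟩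
  | p :: F => F.foldl (fun X p => HASC m n p.2 (VASC m n p.1 X)) (VALL m n p.2 p.1)

/-! Alternating values of an index. -/

/-! Every labeling constructed here has the form `alternatingValue (m * n) (T i j)`, where, with
coordinates counted from `0`, `T` numbers the grid by `0, …, m n - 1`. For `HBBL` the digits of `T`
in mixed radix `m₁, n₁, m₂, n₂, …` are those of `i` and `j`, interlaced: `HALL` uses the two lowest
digits, and each alternating connected sum writes the block number as a new top digit
(`IsAlternating.foldl`). All radices are odd, so `T i j` has the parity of `i + j`. Hence twice a
label is `T + 2` at even vertices and `2 m n - T + 1` at odd ones, and a 4-cycle sums to `2 m n + 3`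
as soon as its two diagonals have the same sum of `T`. On inner faces this holds because `T` is a
function of `i` plus a function of `j`; on crossing faces each diagonal is a pair of centrally
symmetric vertices, where `T` sums to `m n - 1`. That symmetry also gives the balance, and
monotonicity of `T` gives standardness (`IsGridIndex.isStandardBicentrallyBalanced`). Distinct
sequences give distinct labelings because `T` can be read off from the labels and the radices from
`T` (`IsReducedSeq.eq_of_mixedRadixIndex_eq`). The `VBBL` claims follow by transposition. -/

/-- The `t`-th term of the sequence `1, K, 2, K - 1, 3, …`. -/
def alternatingValue (K : ℤ) (t : ℕ) : ℤ :=
  if Even t then 1 + (t / 2 : ℕ) else K - (t / 2 : ℕ)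

/-- Doubling clears the floor, so that later label computations are linear in `t`. -/
lemma two_mul_alternatingValue_of_even (K : ℤ) {t : ℕ} (h : Even t) :
    2 * alternatingValue K t = t + 2 := by
  rw [alternatingValue, if_pos h]
  obtain ⟨r, rfl⟩ := h
  omega

lemma two_mul_alternatingValue_of_not_even (K : ℤ) {t : ℕ} (h : ¬ Even t) :
    2 * alternatingValue K t = 2 * K - t + 1 := by
  rw [alternatingValue, if_neg h]
  rw [Nat.even_iff] at h
  omega

lemma alternatingValue_mem_Icc (K : ℕ) {t : ℕ} (h : t < K) :
    alternatingValue K t ∈ Set.Icc (1 : ℤ) K := by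
  rw [Set.mem_Icc]
  by_cases ht : Even t
  · have := two_mul_alternatingValue_of_even K ht
    omega
  · have := two_mul_alternatingValue_of_not_even K ht
    omega

lemma alternatingValue_injOn (K : ℕ) {s t : ℕ} (hs : s < K) (ht : t < K)
    (h : alternatingValue K s = alternatingValue K t) : s = t := by
  by_cases hs' : Even s <;> by_cases ht' : Even t
  · have h1 := two_mul_alternatingValue_of_even K hs'
    have h2 := two_mul_alternatingValue_of_even K ht'
    omega
  · have h1 := two_mul_alternatingValue_of_even K hs'
    have h2 := two_mul_alternatingValue_of_not_even K ht'
    omega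
  · have h1 := two_mul_alternatingValue_of_not_even K hs'
    have h2 := two_mul_alternatingValue_of_even K ht'
    omega
  · have h1 := two_mul_alternatingValue_of_not_even K hs'
    have h2 := two_mul_alternatingValue_of_not_even K ht'
    omega

/-! Indexings of a grid whose coordinates are counted from `0`. -/

/-- The properties of an indexing of the `m × n` grid by `0, …, m n - 1` which make its
alternating values a standard bicentrally balanced labeling. -/
structure IsGridIndex (m n : ℕ) (T : ℕ → ℕ → ℕ) : Prop where
  add_comm : ∀ i j i' j', T i j + T i' j' = T i j' + T i' j
  symm : ∀ i j i' j', i + i' + 1 = m → j + j' + 1 = n → T i j + T i' j' + 1 = m * n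
  left_lt : ∀ i i' j, i < i' → i' < m → j < n → T i j < T i' j
  right_lt : ∀ i j j', i < m → j < j' → j' < n → T i j < T i j'
  even : ∀ i j, i < m → j < n → (Even (T i j) ↔ Even (i + j))
  inj : ∀ i j i' j', i < m → j < n → i' < m → j' < n → T i j = T i' j' → i = i' ∧ j = j'

namespace IsGridIndex

variable {m n : ℕ} {T : ℕ → ℕ → ℕ}

lemma swap (h : IsGridIndex m n T) : IsGridIndex n m fun i j => T j i where
  add_comm i j i' j' := by rw [h.add_comm j i j' i', Nat.add_comm]
  symm i j i' j' hi hj := by rw [h.symm j i j' i' hj hi, Nat.mul_comm]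
  left_lt i i' j hi hi' hj := h.right_lt j i i' hj hi hi'
  right_lt i j j' hi hj hj' := h.left_lt j j' i hj hj' hi
  even i j hi hj := by rw [h.even j i hj hi, Nat.add_comm]
  inj i j i' j' hi hj hi' hj' e := (h.inj j i j' i' hj hi hj' hi' e).symm

lemma lt_mul (h : IsGridIndex m n T) {i j : ℕ} (hi : i < m) (hj : j < n) : T i j < m * n := by
  have := h.symm i j (m - 1 - i) (n - 1 - j) (by omega) (by omega)
  omega

lemma zero : IsGridIndex 1 1 fun _ _ => 0 where
  add_comm _ _ _ _ := rfl
  symm _ _ _ _ _ _ := rfl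
  left_lt _ _ _ _ _ _ := by omega
  right_lt _ _ _ _ _ _ := by omega
  even i j hi hj := by
    obtain rfl : i = 0 := by omega
    obtain rfl : j = 0 := by omega
    rfl
  inj _ _ _ _ _ _ _ _ _ := by omega

/-- A new lowest digit is split off from `i`. Parity survives because `p` is odd, so that `i` is
congruent mod `2` to `i % p + i / p`. -/
lemma refine_left (h : IsGridIndex m n T) {p : ℕ} (hp : Odd p) :
    IsGridIndex (p * m) n fun i j => i % p + p * T (i / p) j where
  add_comm i j i' j' := by
    have := congrArg (p * ·) (h.add_comm (i / p) j (i' / p) j')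
    simp only [mul_add] at this
    omega
  symm i j i' j' hi hj := by
    have h1 := Nat.div_add_mod i p
    have h2 := Nat.div_add_mod i' p
    have h3 := Nat.mod_lt i hp.pos
    have h4 := Nat.mod_lt i' hp.pos
    -- The reflection of `i` complements each digit without carry: the two remainders plus `1` lie
    -- between `1` and `2 p - 1` and must be a multiple of `p`.
    have hq : i / p + i' / p + 1 = m := by
      have e : p * (i / p + i' / p) + (i % p + i' % p + 1) = p * m := by
        rw [mul_add]; omega
      have l1 : i / p + i' / p < m := by
        by_contra hc
        have := Nat.mul_le_mul_left p (not_lt.1 hc)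
        omega
      have l2 : m < i / p + i' / p + 2 := by
        by_contra hc
        have := Nat.mul_le_mul_left p (not_lt.1 hc)
        rw [mul_add] at this
        omega
      omega
    have hr : i % p + i' % p + 1 = p := by
      have : p * (i / p + i' / p + 1) = p * m := by rw [hq]
      simp only [mul_add] at this
      omega
    have := congrArg (p * ·) (h.symm _ _ _ _ hq hj)
    simp only [mul_add, ← mul_assoc] at this
    omega
  left_lt i i' j hi hi' hj := by
    have h1 := Nat.div_add_mod i p
    have h2 := Nat.div_add_mod i' p
    have h3 := Nat.mod_lt i hp.pos
    rcases (Nat.div_le_div_right hi.le : i / p ≤ i' / p).lt_or_eq with hd | hd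
    · have := Nat.mul_le_mul_left p (h.left_lt _ _ _ hd (Nat.div_lt_of_lt_mul hi') hj)
      rw [Nat.mul_succ] at this
      omega
    · simp only [hd] at h1 ⊢
      omega
  right_lt i j j' hi hj hj' := by
    have := Nat.mul_lt_mul_of_pos_left
      (h.right_lt _ _ _ (Nat.div_lt_of_lt_mul hi) hj hj') hp.pos
    omega
  even i j hi hj := by
    have h1 : Even (p * (i / p) + i % p) ↔ Even i := by rw [Nat.div_add_mod]
    have h2 := h.even _ _ (Nat.div_lt_of_lt_mul hi) hj
    have hp' := Nat.not_even_iff_odd.2 hp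
    simp only [Nat.even_add, Nat.even_mul, hp', false_or] at h1 h2 ⊢
    tauto
  inj i j i' j' hi hj hi' hj' e := by
    have hmod : i % p = i' % p := by
      have := congrArg (· % p) e
      simpa using this
    rw [hmod, Nat.add_left_cancel_iff] at e
    obtain ⟨hd, rfl⟩ := h.inj _ _ _ _ (Nat.div_lt_of_lt_mul hi) hj (Nat.div_lt_of_lt_mul hi') hj'
      (Nat.eq_of_mul_eq_mul_left hp.pos e)
    refine ⟨?_, rfl⟩
    rw [← Nat.div_add_mod i p, ← Nat.div_add_mod i' p, hd, hmod]

/-! ### From grid indices to standard bicentrally balanced labelings. -/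

lemma isStandardBicentrallyBalanced (h : IsGridIndex m n T) (hm : Odd m) (hn : Odd n)
    {X : GridLabeling} (hw : X.width = m) (hh : X.height = n)
    (hX : ∀ i j, i < m → j < n → X.label (i + 1, j + 1) = alternatingValue (m * n : ℕ) (T i j)) :
    IsStandardBicentrallyBalanced m n X := by
  have hX_even : ∀ i j, 1 ≤ i → i ≤ m → 1 ≤ j → j ≤ n → Even (i + j) →
      2 * X.label (i, j) = T (i - 1) (j - 1) + 2 := by
    intro i j hi hi' hj hj' he
    obtain ⟨i, rfl⟩ := Nat.exists_eq_add_of_le' hi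
    obtain ⟨j, rfl⟩ := Nat.exists_eq_add_of_le' hj
    rw [hX i j hi' hj', two_mul_alternatingValue_of_even]
    · simp
    · rw [h.even i j hi' hj']
      rw [Nat.even_iff] at he ⊢
      omega
  have hX_odd : ∀ i j, 1 ≤ i → i ≤ m → 1 ≤ j → j ≤ n → ¬ Even (i + j) →
      2 * X.label (i, j) = 2 * (m * n) - T (i - 1) (j - 1) + 1 := by
    intro i j hi hi' hj hj' he
    obtain ⟨i, rfl⟩ := Nat.exists_eq_add_of_le' hi
    obtain ⟨j, rfl⟩ := Nat.exists_eq_add_of_le' hj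
    rw [hX i j hi' hj', two_mul_alternatingValue_of_not_even]
    · simp
    · rw [h.even i j hi' hj']
      rw [Nat.even_iff] at he ⊢
      omega
  -- Vertices 1, 2 form one diagonal and 3, 4 the other, of opposite parity, so `T` enters with
  -- opposite signs and cancels.
  have face : ∀ i₁ j₁ i₂ j₂ i₃ j₃ i₄ j₄ : ℕ, (i₁, j₁) ∈ projGridVertices m n →
      (i₂, j₂) ∈ projGridVertices m n → (i₃, j₃) ∈ projGridVertices m n →
      (i₄, j₄) ∈ projGridVertices m n → (Even (i₁ + j₁) ↔ Even (i₂ + j₂)) →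
      (Even (i₁ + j₁) ↔ ¬ Even (i₃ + j₃)) → (Even (i₁ + j₁) ↔ ¬ Even (i₄ + j₄)) →
      T (i₁ - 1) (j₁ - 1) + T (i₂ - 1) (j₂ - 1) = T (i₃ - 1) (j₃ - 1) + T (i₄ - 1) (j₄ - 1) →
      X.label (i₁, j₁) + X.label (i₂, j₂) + X.label (i₃, j₃) + X.label (i₄, j₄)
        = 2 * m * n + 3 := by
    rintro i₁ j₁ i₂ j₂ i₃ j₃ i₄ j₄ ⟨a1, a2, a3, a4⟩ ⟨b1, b2, b3, b4⟩ ⟨c1, c2, c3, c4⟩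
      ⟨d1, d2, d3, d4⟩ e2 e3 e4 hT
    dsimp only at *
    rw [mul_assoc]
    by_cases e1 : Even (i₁ + j₁)
    · have l1 := hX_even i₁ j₁ a1 a2 a3 a4 e1
      have l2 := hX_even i₂ j₂ b1 b2 b3 b4 (e2.1 e1)
      have l3 := hX_odd i₃ j₃ c1 c2 c3 c4 (e3.1 e1)
      have l4 := hX_odd i₄ j₄ d1 d2 d3 d4 (e4.1 e1)
      linarith [(by exact_mod_cast hT : (T (i₁ - 1) (j₁ - 1) : ℤ) + T (i₂ - 1) (j₂ - 1)
        = T (i₃ - 1) (j₃ - 1) + T (i₄ - 1) (j₄ - 1))]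
    · have l1 := hX_odd i₁ j₁ a1 a2 a3 a4 e1
      have l2 := hX_odd i₂ j₂ b1 b2 b3 b4 (fun h' => e1 (e2.2 h'))
      have l3 := hX_even i₃ j₃ c1 c2 c3 c4 (by tauto)
      have l4 := hX_even i₄ j₄ d1 d2 d3 d4 (by tauto)
      linarith [(by exact_mod_cast hT : (T (i₁ - 1) (j₁ - 1) : ℤ) + T (i₂ - 1) (j₂ - 1)
        = T (i₃ - 1) (j₃ - 1) + T (i₄ - 1) (j₄ - 1))]
  have hm' := Nat.odd_iff.1 hm
  have hn' := Nat.odd_iff.1 hn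
  have hsymm : ∀ i j i' j', i + i' = m + 1 → j + j' = n + 1 → 1 ≤ i → i ≤ m → 1 ≤ j → j ≤ n →
      T (i - 1) (j - 1) + T (i' - 1) (j' - 1) + 1 = m * n := fun i j i' j' hi hj _ _ _ _ =>
    h.symm _ _ _ _ (by omega) (by omega)
  have inj : Set.InjOn X.label (projGridVertices m n) := by
    rintro ⟨i, j⟩ ⟨hi, hi', hj, hj'⟩ ⟨k, l⟩ ⟨hk, hk', hl, hl'⟩ e
    dsimp only at *
    obtain ⟨i, rfl⟩ := Nat.exists_eq_add_of_le' hi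
    obtain ⟨j, rfl⟩ := Nat.exists_eq_add_of_le' hj
    obtain ⟨k, rfl⟩ := Nat.exists_eq_add_of_le' hk
    obtain ⟨l, rfl⟩ := Nat.exists_eq_add_of_le' hl
    rw [hX i j hi' hj', hX k l hk' hl'] at e
    obtain ⟨rfl, rfl⟩ := h.inj i j k l hi' hj' hk' hl'
      (alternatingValue_injOn _ (h.lt_mul hi' hj') (h.lt_mul hk' hl') e)
    rfl
  have maps : Set.MapsTo X.label (projGridVertices m n) (Set.Icc 1 ((m : ℤ) * n)) := by
    rintro ⟨i, j⟩ ⟨hi, hi', hj, hj'⟩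
    dsimp only at *
    obtain ⟨i, rfl⟩ := Nat.exists_eq_add_of_le' hi
    obtain ⟨j, rfl⟩ := Nat.exists_eq_add_of_le' hj
    rw [hX i j hi' hj']
    simpa using alternatingValue_mem_Icc _ (h.lt_mul hi' hj')
  -- An injection between finite sets of equal size is onto.
  have surj : Set.SurjOn X.label (projGridVertices m n) (Set.Icc 1 ((m : ℤ) * n)) := by
    have e : projGridVertices m n = ↑(Finset.Icc 1 m ×ˢ Finset.Icc 1 n) := by
      ext ⟨i, j⟩
      simp only [projGridVertices, Set.mem_ofPred_eq, Finset.coe_product, Finset.coe_Icc,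
        Set.mem_prod, Set.mem_Icc, and_assoc]
    have e' : Set.Icc 1 ((m : ℤ) * n) = ↑(Finset.Icc 1 ((m : ℤ) * n)) := by simp
    rw [e, e'] at maps
    rw [e] at inj
    rw [e, e']
    refine Finset.surjOn_of_injOn_of_card_le _ maps inj ?_
    simp only [Int.card_Icc, Finset.card_product, Nat.card_Icc, Nat.add_sub_cancel,
      add_sub_cancel_right]
    exact_mod_cast (Int.toNat_natCast (m * n)).le
  refine ⟨⟨⟨hw, hh, ⟨maps, inj, surj⟩, ?_⟩, ?_⟩, ?_, ?_, ?_, ?_⟩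
  · intro f hf hlen
    cases hf with
    | inner i j hi hi' hj hj' =>
      have := face i j (i + 1) (j + 1) i (j + 1) (i + 1) j
        (by simp only [projGridVertices, Set.mem_ofPred_eq]; omega)
        (by simp only [projGridVertices, Set.mem_ofPred_eq]; omega)
        (by simp only [projGridVertices, Set.mem_ofPred_eq]; omega)
        (by simp only [projGridVertices, Set.mem_ofPred_eq]; omega)
        (by simp only [Nat.even_iff]; omega) (by simp only [Nat.even_iff]; omega)
        (by simp only [Nat.even_iff]; omega) (h.add_comm _ _ _ _)
      simp only [List.map_cons, List.map_nil, List.sum_cons, List.sum_nil]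
      linarith
    | crossTop i hi hi' =>
      -- Both diagonals are centrally symmetric pairs, so each has index sum `m n - 1`.
      have h1 := hsymm i n (m + 1 - i) 1 (by omega) (by omega) (by omega) (by omega) (by omega)
        (by omega)
      have h2 := hsymm (i + 1) n (m - i) 1 (by omega) (by omega) (by omega) (by omega) (by omega)
        (by omega)
      have := face i n (m + 1 - i) 1 (m - i) 1 (i + 1) n
        (by simp only [projGridVertices, Set.mem_ofPred_eq]; omega)
        (by simp only [projGridVertices, Set.mem_ofPred_eq]; omega)
        (by simp only [projGridVertices, Set.mem_ofPred_eq]; omega)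
        (by simp only [projGridVertices, Set.mem_ofPred_eq]; omega)
        (by simp only [Nat.even_iff]; omega) (by simp only [Nat.even_iff]; omega)
        (by simp only [Nat.even_iff]; omega) (by omega)
      simp only [List.map_cons, List.map_nil, List.sum_cons, List.sum_nil]
      linarith
    | crossRight j hj hj' =>
      have h1 := hsymm m j 1 (n + 1 - j) (by omega) (by omega) (by omega) (by omega) (by omega)
        (by omega)
      have h2 := hsymm m (j + 1) 1 (n - j) (by omega) (by omega) (by omega) (by omega) (by omega)
        (by omega)
      have := face m j 1 (n + 1 - j) 1 (n - j) m (j + 1)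
        (by simp only [projGridVertices, Set.mem_ofPred_eq]; omega)
        (by simp only [projGridVertices, Set.mem_ofPred_eq]; omega)
        (by simp only [projGridVertices, Set.mem_ofPred_eq]; omega)
        (by simp only [projGridVertices, Set.mem_ofPred_eq]; omega)
        (by simp only [Nat.even_iff]; omega) (by simp only [Nat.even_iff]; omega)
        (by simp only [Nat.even_iff]; omega) (by omega)
      simp only [List.map_cons, List.map_nil, List.sum_cons, List.sum_nil]
      linarith
    | digonOne => simp at hlen
    | digonTwo => simp at hlen
  · rintro i j ⟨hi, hi', hj, hj'⟩
    dsimp only at *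
    have hs := hsymm i j (m + 1 - i) (n + 1 - j) (by omega) (by omega) hi hi' hj hj'
    zify at hs
    split_ifs with he
    · have h1 := hX_even i j hi hi' hj hj' he
      have h2 := hX_even (m + 1 - i) (n + 1 - j) (by omega) (by omega) (by omega) (by omega)
        (by rw [Nat.even_iff] at he ⊢; omega)
      linarith
    · have h1 := hX_odd i j hi hi' hj hj' he
      have h2 := hX_odd (m + 1 - i) (n + 1 - j) (by omega) (by omega) (by omega) (by omega)
        (by rw [Nat.even_iff] at he ⊢; omega)
      linarith
  · intro i hi hi' he
    have h1 := hX_even i ((n + 1) / 2) hi (by omega) (by omega) (by omega) he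
    have h2 := hX_even (i + 2) ((n + 1) / 2) (by omega) hi' (by omega) (by omega)
      (by rw [Nat.even_iff] at he ⊢; omega)
    have h3 := h.left_lt (i - 1) (i + 2 - 1) ((n + 1) / 2 - 1) (by omega) (by omega) (by omega)
    omega
  · intro i hi hi' he
    rw [← Nat.not_even_iff_odd] at he
    have h1 := hX_odd i ((n + 1) / 2) hi (by omega) (by omega) (by omega) he
    have h2 := hX_odd (i + 2) ((n + 1) / 2) (by omega) hi' (by omega) (by omega)
      (by rw [Nat.even_iff] at he ⊢; omega)
    have h3 := h.left_lt (i - 1) (i + 2 - 1) ((n + 1) / 2 - 1) (by omega) (by omega) (by omega)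
    omega
  · intro j hj hj' he
    have h1 := hX_even ((m + 1) / 2) j (by omega) (by omega) hj (by omega) he
    have h2 := hX_even ((m + 1) / 2) (j + 2) (by omega) (by omega) (by omega) hj'
      (by rw [Nat.even_iff] at he ⊢; omega)
    have h3 := h.right_lt ((m + 1) / 2 - 1) (j - 1) (j + 2 - 1) (by omega) (by omega) (by omega)
    omega
  · intro j hj hj' he
    rw [← Nat.not_even_iff_odd] at he
    have h1 := hX_odd ((m + 1) / 2) j (by omega) (by omega) hj (by omega) he
    have h2 := hX_odd ((m + 1) / 2) (j + 2) (by omega) (by omega) (by omega) hj'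
      (by rw [Nat.even_iff] at he ⊢; omega)
    have h3 := h.right_lt ((m + 1) / 2 - 1) (j - 1) (j + 2 - 1) (by omega) (by omega) (by omega)
    omega

end IsGridIndex

/-! The mixed radix index of a factorization sequence. -/

/-- The index of the position `(i, j)`, counted from `0`, whose mixed radix digits are those of
`i` with respect to `m₁, m₂, …` interlaced with those of `j` with respect to `n₁, n₂, …`. -/
def mixedRadixIndex : List (ℕ × ℕ) → ℕ → ℕ → ℕ
  | [] => fun _ _ => 0
  | p :: F => fun i j => i % p.1 + p.1 * (j % p.2 + p.2 * mixedRadixIndex F (i / p.1) (j / p.2))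

lemma isGridIndex_mixedRadixIndex {F : List (ℕ × ℕ)} (hF : ∀ p ∈ F, Odd p.1 ∧ Odd p.2) :
    IsGridIndex (F.map Prod.fst).prod (F.map Prod.snd).prod (mixedRadixIndex F) := by
  induction F with
  | nil => exact .zero
  | cons p F ih =>
    rw [List.forall_mem_cons] at hF
    -- The digit of `j` is inserted first, then the digit of `i` below it.
    exact (((ih hF.2).swap.refine_left hF.1.2).swap.refine_left hF.1.1)

lemma mixedRadixIndex_zero_zero (F : List (ℕ × ℕ)) : mixedRadixIndex F 0 0 = 0 := by
  induction F with
  | nil => rfl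
  | cons p F ih => simp [mixedRadixIndex, ih]

/-! ### Recovering the factorization sequence from its index. -/

/-- Lists of pairs in which the first entries are greater than `1`, and the second entries too,
except that the very last one may be `1`. -/
def IsReducedSeq : List (ℕ × ℕ) → Prop
  | [] => True
  | p :: F => 1 < p.1 ∧ (1 < p.2 ∨ p.2 = 1 ∧ F = []) ∧ IsReducedSeq F

lemma isReduced_of_forall {F : List (ℕ × ℕ)} (h : ∀ p ∈ F, 1 < p.1 ∧ 1 < p.2) :
    IsReducedSeq F := by
  induction F with
  | nil => trivial
  | cons p F ih =>
    rw [List.forall_mem_cons] at h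
    exact ⟨h.1.1, .inl h.1.2, ih h.2⟩

lemma isReduced_append {F : List (ℕ × ℕ)} (h : ∀ p ∈ F, 1 < p.1 ∧ 1 < p.2) {a : ℕ} (ha : 1 < a) :
    IsReducedSeq (F ++ [(a, 1)]) := by
  induction F with
  | nil => exact ⟨ha, .inr ⟨rfl, rfl⟩, trivial⟩
  | cons p F ih =>
    rw [List.forall_mem_cons] at h
    exact ⟨h.1.1, .inl h.1.2, ih h.2⟩

namespace IsProjFactorizationSeq

variable {m n : ℕ} {F : List (ℕ × ℕ)}

/-- Reducedness passes to tails, as an induction on the list requires; being a factorization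
sequence does not, since `[]` and `[(a, 1)]` are excluded. -/
lemma isReduced (h : IsProjFactorizationSeq m n F) : IsReducedSeq F := by
  obtain ⟨-, -, ⟨-, h⟩ | ⟨G, a, -, h, ha, rfl⟩⟩ := h
  · exact isReduced_of_forall h
  · exact isReduced_append h ha

lemma ne_nil (h : IsProjFactorizationSeq m n F) : F ≠ [] := by
  obtain ⟨-, -, ⟨h, -⟩ | ⟨G, a, -, -, -, rfl⟩⟩ := h
  · exact h
  · simp

lemma odd (h : IsProjFactorizationSeq m n F) (hm : Odd m) (hn : Odd n) :
    ∀ p ∈ F, Odd p.1 ∧ Odd p.2 := fun _ hp =>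
  ⟨hm.of_dvd_nat (h.1 ▸ List.dvd_prod (List.mem_map_of_mem hp)),
    hn.of_dvd_nat (h.2.1 ▸ List.dvd_prod (List.mem_map_of_mem hp))⟩

end IsProjFactorizationSeq

namespace IsReducedSeq

lemma pos {F : List (ℕ × ℕ)} (h : IsReducedSeq F) :
    0 < (F.map Prod.fst).prod ∧ 0 < (F.map Prod.snd).prod := by
  induction F with
  | nil => simp
  | cons p F ih =>
    obtain ⟨h1, h2, h3⟩ := h
    have := ih h3
    simp only [List.map_cons, List.prod_cons]
    exact ⟨Nat.mul_pos (by omega) this.1, Nat.mul_pos (by omega) this.2⟩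

lemma eq_nil {F : List (ℕ × ℕ)} (h : IsReducedSeq F) (h1 : (F.map Prod.fst).prod = 1) : F = [] := by
  cases F with
  | nil => rfl
  | cons p F =>
    rw [List.map_cons, List.prod_cons] at h1
    have := Nat.eq_one_of_mul_eq_one_right h1
    have := h.1
    omega

/-- The mixed radix index determines the sequence. -/
lemma eq_of_mixedRadixIndex_eq {F G : List (ℕ × ℕ)} (hF : IsReducedSeq F) (hG : IsReducedSeq G)
    (h1 : (F.map Prod.fst).prod = (G.map Prod.fst).prod)
    (h2 : (F.map Prod.snd).prod = (G.map Prod.snd).prod)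
    (h : ∀ i j, i < (F.map Prod.fst).prod → j < (F.map Prod.snd).prod →
      mixedRadixIndex F i j = mixedRadixIndex G i j) : F = G := by
  induction F generalizing G with
  | nil => exact (hG.eq_nil (by simpa using h1.symm)).symm
  | cons a F ih =>
    cases G with
    | nil => exact hF.eq_nil (by simpa using h1)
    | cons b G =>
      obtain ⟨p, q⟩ := a
      obtain ⟨p', q'⟩ := b
      obtain ⟨hp, hq, hF⟩ := hF
      obtain ⟨hp', hq', hG⟩ := hG
      simp only [List.map_cons, List.prod_cons, mixedRadixIndex] at *
      have posF := hF.pos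
      have posG := hG.pos
      set M := (F.map Prod.fst).prod
      set N := (F.map Prod.snd).prod
      -- In this case both lists are single pairs with second entry `1`, and the products of first
      -- entries decide.
      by_cases hn : q * N = 1
      · have eq1 := Nat.eq_one_of_mul_eq_one_right hn
        have eq2 := Nat.eq_one_of_mul_eq_one_right (h2 ▸ hn)
        obtain rfl := (hq.resolve_left (by omega)).2
        obtain rfl := (hq'.resolve_left (by omega)).2
        simp_all [M]
      · have q1 : 1 < q := by
          rcases hq with hq | ⟨rfl, rfl⟩
          · exact hq
          · simp [N] at hn
        have q1' : 1 < q' := by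
          rcases hq' with hq | ⟨rfl, rfl⟩
          · exact hq
          · simp [h2] at hn
        have hpM : 0 < p * M := Nat.mul_pos (by omega) posF.1
        have hqN : 0 < q * N := Nat.mul_pos (by omega) posF.2
        -- The index at `(0, 1)` is the weight of the lowest digit of `j`, namely the first radix.
        obtain rfl : p = p' := by
          have := h 0 1 hpM (by omega)
          simpa [Nat.mod_eq_of_lt q1, Nat.mod_eq_of_lt q1', Nat.div_eq_of_lt q1,
            Nat.div_eq_of_lt q1', mixedRadixIndex_zero_zero] using this
        have hM : M = (G.map Prod.fst).prod := Nat.eq_of_mul_eq_mul_left (by omega) h1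
        by_cases hM1 : M = 1
        · obtain rfl := hF.eq_nil hM1
          obtain rfl := hG.eq_nil (hM ▸ hM1)
          simp_all [N]
        · have index_one_zero : ∀ H : List (ℕ × ℕ), IsReducedSeq H → (H.map Prod.fst).prod = M →
              mixedRadixIndex H 1 0 = 1 := by
            intro H hH e
            cases H with
            | nil => simp at e; omega
            | cons c H =>
              simp [mixedRadixIndex, Nat.mod_eq_of_lt hH.1, Nat.div_eq_of_lt hH.1,
                mixedRadixIndex_zero_zero]
          have pM : p < p * M := lt_mul_of_one_lt_right (by omega) (by omega)
          have p0 : 0 < p := by omega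
          -- The index at `(p, 0)` is the weight `p * q` of the second digit of `i`, which exists
          -- because `M ≠ 1`.
          obtain rfl : q = q' := by
            have := h p 0 pM hqN
            simp only [Nat.mod_self, Nat.div_self p0, Nat.zero_mod, Nat.zero_div, zero_add,
              index_one_zero F hF rfl, index_one_zero G hG hM.symm, mul_one] at this
            exact Nat.eq_of_mul_eq_mul_left p0 this
          have q0 : 0 < q := by omega
          rw [ih hF hG hM (Nat.eq_of_mul_eq_mul_left q0 h2)]
          intro i j hi hj
          -- At these points the two lowest digits vanish, leaving `p * q` times the index of the
          -- tail.
          have := h (p * i) (q * j) (Nat.mul_lt_mul_of_pos_left hi p0)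
            (Nat.mul_lt_mul_of_pos_left hj q0)
          simp only [Nat.mul_mod_right, Nat.mul_div_cancel_left _ p0, Nat.mul_div_cancel_left _ q0,
            zero_add] at this
          exact Nat.eq_of_mul_eq_mul_left q0 (Nat.eq_of_mul_eq_mul_left p0 this)

end IsReducedSeq

/-! The labelings are alternating values of mixed radix indices. -/

/-- The labels of `X` are the alternating values of `T`, an index with the parity of the
position. -/
def IsAlternating (K : ℤ) (X : GridLabeling) (T : ℕ → ℕ → ℕ) : Prop :=
  ∀ i j, X.label (i + 1, j + 1) = alternatingValue K (T i j) ∧ (Even (T i j) ↔ Even (i + j))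

/-- Moving to block `q` shifts the index by `q m n`. For `q` even the shift keeps the parity of the
index and moves the label by half the shift, up or down; for `q` odd it flips the parity and
exchanges the two branches of the sequence, which explains the reflected label. -/
lemma alternatingLabel_alternatingValue (M N : ℕ) {m n q i j t : ℕ} (hm : Odd m) (hn : Odd n)
    (ht : Even t ↔ Even (i + j)) :
    alternatingLabel M N m n q (i + 1) (j + 1) (alternatingValue (M * N) t) =
      alternatingValue (M * N) (t + q * (m * n)) := by
  have hmn : Odd (m * n) := hm.mul hn
  have hpar : Odd (i + 1 + (j + 1)) ↔ ¬ Even t := by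
    rw [ht, Nat.odd_iff, Nat.even_iff]
    omega
  have hpar' : Even (t + q * (m * n)) ↔ (Even t ↔ Even q) := by
    rw [Nat.even_add, Nat.even_mul (m := q), or_iff_left (Nat.not_even_iff_odd.2 hmn)]
  simp only [alternatingLabel, hpar]
  rcases Nat.even_or_odd q with hq | hq
  · rw [if_neg (Nat.not_odd_iff_even.2 hq)]
    obtain ⟨k, rfl⟩ := hq
    rw [show (k + k + 1) / 2 = k by omega]
    by_cases he : Even t
    · have e1 := two_mul_alternatingValue_of_even ((M : ℤ) * N) he
      have e2 := two_mul_alternatingValue_of_even ((M : ℤ) * N) (hpar'.2 (by simp [he]))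
      rw [if_neg (not_not.2 he)]
      push_cast at e2
      linarith
    · have e1 := two_mul_alternatingValue_of_not_even ((M : ℤ) * N) he
      have e2 := two_mul_alternatingValue_of_not_even ((M : ℤ) * N)
        (mt hpar'.1 (by simp [he]))
      rw [if_pos he]
      push_cast at e2
      linarith
  · rw [if_pos hq]
    have hqmn : Odd (q * (m * n)) := hq.mul hmn
    have hk : (2 * (((q + 1) / 2 : ℕ) : ℤ) - 1) = q := by
      rw [Nat.odd_iff] at hq
      omega
    have hq' := Nat.not_even_iff_odd.2 hq
    rw [hk, show (q : ℤ) * (m * n) = (q * (m * n) : ℕ) by push_cast; ring]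
    -- Only the oddness of this product matters now; it makes the division by `2` exact.
    generalize q * (m * n) = s at *
    rw [Nat.odd_iff] at hqmn
    by_cases he : Even t
    · have e1 := two_mul_alternatingValue_of_even ((M : ℤ) * N) he
      have e2 := two_mul_alternatingValue_of_not_even ((M : ℤ) * N)
        (mt hpar'.1 (by simp [he, hq']))
      rw [if_neg (not_not.2 he)]
      omega
    · have e1 := two_mul_alternatingValue_of_not_even ((M : ℤ) * N) he
      have e2 := two_mul_alternatingValue_of_even ((M : ℤ) * N) (hpar'.2 (by simp [he, hq']))
      rw [if_pos he]
      omega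

/-- The four formulas of `HALL` are the two branches of the alternating sequence, split by the
parities of `i` and `j`. -/
lemma isAlternating_HALL (M N n : ℕ) {m : ℕ} (hm : Odd m) :
    IsAlternating (M * N) (HALL M N m n) fun i j => i + m * j := by
  intro i j
  have hm' := Nat.not_even_iff_odd.2 hm
  have hpar : Even (i + m * j) ↔ Even (i + j) := by
    simp only [Nat.even_add, Nat.even_mul, hm', false_or]
  refine ⟨?_, hpar⟩
  obtain ⟨a, rfl⟩ := hm
  simp only [HALL, show (2 * a + 1 + 1) / 2 = a + 1 by omega]
  rcases Nat.even_or_odd' i with ⟨k, rfl | rfl⟩ <;> rcases Nat.even_or_odd' j with ⟨l, rfl | rfl⟩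
  · have e := two_mul_alternatingValue_of_even ((M : ℤ) * N)
      (hpar.2 (by rw [Nat.even_iff]; omega))
    rw [if_pos (by rw [Nat.odd_iff]; omega), if_pos (by rw [Nat.odd_iff]; omega),
      show (2 * k + 1 + 1) / 2 = k + 1 by omega, show (2 * l + 1 + 1) / 2 = l + 1 by omega]
    push_cast at e ⊢
    linarith
  · have e := two_mul_alternatingValue_of_not_even ((M : ℤ) * N)
      (mt hpar.1 (by rw [Nat.even_iff]; omega))
    rw [if_pos (by rw [Nat.odd_iff]; omega), if_neg (by rw [Nat.odd_iff]; omega),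
      show (2 * k + 1 + 1) / 2 = k + 1 by omega, show (2 * l + 1 + 1 + 1) / 2 = l + 1 by omega]
    push_cast at e ⊢
    linarith
  · have e := two_mul_alternatingValue_of_not_even ((M : ℤ) * N)
      (mt hpar.1 (by rw [Nat.even_iff]; omega))
    rw [if_neg (by rw [Nat.odd_iff]; omega), if_pos (by rw [Nat.odd_iff]; omega),
      show (2 * k + 1 + 1 + 1) / 2 = k + 1 by omega, show (2 * l + 1 + 1) / 2 = l + 1 by omega]
    push_cast at e ⊢
    linarith
  · have e := two_mul_alternatingValue_of_even ((M : ℤ) * N)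
      (hpar.2 (by rw [Nat.even_iff]; omega))
    rw [if_neg (by rw [Nat.odd_iff]; omega), if_neg (by rw [Nat.odd_iff]; omega),
      show (2 * k + 1 + 1 + 1) / 2 = k + 1 by omega, show (2 * l + 1 + 1 + 1) / 2 = l + 1 by omega]
    push_cast at e ⊢
    linarith

namespace IsAlternating

variable {M N : ℕ} {X : GridLabeling} {T : ℕ → ℕ → ℕ}

lemma hasc (h : IsAlternating (M * N) X T) (r : ℕ) (hw : Odd X.width) (hh : Odd X.height) :
    IsAlternating (M * N) (HASC M N r X)
      fun i j => T (i % X.width) j + i / X.width * (X.width * X.height) := by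
  intro i j
  obtain ⟨h1, h2⟩ := h (i % X.width) j
  constructor
  · simp only [HASC, Nat.add_sub_cancel, h1]
    exact alternatingLabel_alternatingValue M N hw hh h2
  · have hi : Even (X.width * (i / X.width) + i % X.width) ↔ Even i := by rw [Nat.div_add_mod]
    have hw' := Nat.not_even_iff_odd.2 hw
    have hh' := Nat.not_even_iff_odd.2 hh
    simp only [Nat.even_add, Nat.even_mul, hw', hh', false_or, or_false] at hi h2 ⊢
    tauto

lemma vasc (h : IsAlternating (M * N) X T) (r : ℕ) (hw : Odd X.width) (hh : Odd X.height) :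
    IsAlternating (M * N) (VASC M N r X)
      fun i j => T i (j % X.height) + j / X.height * (X.width * X.height) := by
  intro i j
  obtain ⟨h1, h2⟩ := h i (j % X.height)
  constructor
  · simp only [VASC, Nat.add_sub_cancel, h1]
    exact alternatingLabel_alternatingValue M N hw hh h2
  · have hi : Even (X.height * (j / X.height) + j % X.height) ↔ Even j := by
      rw [Nat.div_add_mod]
    have hw' := Nat.not_even_iff_odd.2 hw
    have hh' := Nat.not_even_iff_odd.2 hh
    simp only [Nat.even_add, Nat.even_mul, hw', hh', false_or, or_false] at hi h2 ⊢
    tauto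

/-- The fold adds digits at the top, whereas `mixedRadixIndex` recurses from the bottom. The two
agree because a remainder mod `w * p` consists of the remainder mod `w` and the next digit. -/
lemma foldl (F : List (ℕ × ℕ)) (h : IsAlternating (M * N) X T) (hw : Odd X.width)
    (hh : Odd X.height) (hF : ∀ p ∈ F, Odd p.1 ∧ Odd p.2) {i j : ℕ}
    (hi : i < X.width * (F.map Prod.fst).prod) (hj : j < X.height * (F.map Prod.snd).prod) :
    (F.foldl (fun X p => VASC M N p.2 (HASC M N p.1 X)) X).label (i + 1, j + 1) =
      alternatingValue (M * N) (T (i % X.width) (j % X.height) +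
        X.width * X.height * mixedRadixIndex F (i / X.width) (j / X.height)) := by
  induction F generalizing X T with
  | nil =>
    simp only [List.map_nil, List.prod_nil, mul_one] at hi hj
    simp [mixedRadixIndex, Nat.mod_eq_of_lt hi, Nat.mod_eq_of_lt hj, (h i j).1]
  | cons p F ih =>
    rw [List.forall_mem_cons] at hF
    simp only [List.map_cons, List.prod_cons, ← mul_assoc] at hi hj
    rw [List.foldl_cons, ih ((h.hasc p.1 hw hh).vasc p.2 (hw.mul hF.1.1) hh) (hw.mul hF.1.1)
      (hh.mul hF.1.2) hF.2 hi hj]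
    simp only [VASC, HASC, mixedRadixIndex, Nat.mod_mul_right_mod,
      Nat.mod_mul_right_div_self, Nat.div_div_eq_div_mul]
    congr 1
    ring

end IsAlternating

lemma HBBL_width_height (m n : ℕ) (F : List (ℕ × ℕ)) (hF : F ≠ []) :
    (HBBL m n F).width = (F.map Prod.fst).prod ∧ (HBBL m n F).height = (F.map Prod.snd).prod := by
  have key : ∀ (F : List (ℕ × ℕ)) (X : GridLabeling),
      (F.foldl (fun X p => VASC m n p.2 (HASC m n p.1 X)) X).width =
        X.width * (F.map Prod.fst).prod ∧
      (F.foldl (fun X p => VASC m n p.2 (HASC m n p.1 X)) X).height =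
        X.height * (F.map Prod.snd).prod := by
    intro F
    induction F with
    | nil => simp
    | cons p F ih =>
      intro X
      rw [List.foldl_cons, (ih _).1, (ih _).2]
      simp [VASC, HASC, mul_assoc]
  cases F with
  | nil => contradiction
  | cons p F => exact key F _

lemma HBBL_label {m n : ℕ} {F : List (ℕ × ℕ)} (hF : F ≠ []) (hodd : ∀ p ∈ F, Odd p.1 ∧ Odd p.2)
    {i j : ℕ} (hi : i < (F.map Prod.fst).prod) (hj : j < (F.map Prod.snd).prod) :
    (HBBL m n F).label (i + 1, j + 1) = alternatingValue (m * n) (mixedRadixIndex F i j) := by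
  cases F with
  | nil => contradiction
  | cons p F =>
    rw [List.forall_mem_cons] at hodd
    refine ((isAlternating_HALL m n p.2 hodd.1.1).foldl F hodd.1.1 hodd.1.2 hodd.2 hi hj).trans ?_
    simp only [HALL, mixedRadixIndex]
    congr 1
    ring

/-! Transposition. -/

/-- The labeling obtained by interchanging the coordinates. -/
def GridLabeling.transpose (X : GridLabeling) : GridLabeling :=
  ⟨X.height, X.width, fun v => X.label v.swap⟩

lemma alternatingLabel_swap (M N m n q i j : ℕ) (x : ℤ) :
    alternatingLabel M N m n q i j x = alternatingLabel N M n m q j i x := by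
  simp only [alternatingLabel, add_comm i j, mul_comm (m : ℤ) n, mul_comm (M : ℤ) N]

lemma HASC_transpose (M N r : ℕ) (X : GridLabeling) :
    HASC M N r X.transpose = (VASC N M r X).transpose := by
  simp only [HASC, VASC, GridLabeling.transpose, alternatingLabel_swap M N, Prod.swap_prod_mk,
    Prod.fst_swap, Prod.snd_swap]

lemma VASC_transpose (M N r : ℕ) (X : GridLabeling) :
    VASC M N r X.transpose = (HASC N M r X).transpose := by
  simp only [HASC, VASC, GridLabeling.transpose, alternatingLabel_swap M N, Prod.swap_prod_mk,
    Prod.fst_swap, Prod.snd_swap]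

lemma VALL_eq_transpose (M N m n : ℕ) : VALL M N m n = (HALL N M n m).transpose := by
  simp only [VALL, HALL, GridLabeling.transpose, mul_comm (M : ℤ) N, Prod.fst_swap, Prod.snd_swap,
    GridLabeling.mk.injEq, true_and]
  funext v
  split_ifs <;> rfl

/-- Reduces the vertical claims to the horizontal ones on the `n × m` grid. -/
lemma VBBL_eq_transpose (m n : ℕ) (F : List (ℕ × ℕ)) :
    VBBL m n F = (HBBL n m F).transpose := by
  cases F with
  | nil => rfl
  | cons p F =>
    simp only [VBBL, HBBL, VALL_eq_transpose]
    -- The induction on the fold needs an arbitrary starting labeling.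
    generalize HALL n m p.1 p.2 = X
    induction F generalizing X with
    | nil => rfl
    | cons p F ih => rw [List.foldl_cons, List.foldl_cons, VASC_transpose, HASC_transpose, ih]

/-! ### Distinctness of the labelings and the main theorem. -/

/-- Alternating values are injective on indices below `m n`, so equal labels force equal indices,
and these determine the sequence. -/
lemma IsProjFactorizationSeq.eq_of_eqOn {m n : ℕ} (hm : Odd m) (hn : Odd n)
    {F G : List (ℕ × ℕ)} (hF : IsProjFactorizationSeq m n F) (hG : IsProjFactorizationSeq m n G)
    (h : Set.EqOn (HBBL m n F).label (HBBL m n G).label (projGridVertices m n)) : F = G := by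
  have oF := hF.odd hm hn
  have oG := hG.odd hm hn
  have iF := isGridIndex_mixedRadixIndex oF
  have iG := isGridIndex_mixedRadixIndex oG
  refine hF.isReduced.eq_of_mixedRadixIndex_eq hG.isReduced (hF.1.trans hG.1.symm)
    (hF.2.1.trans hG.2.1.symm) fun i j hi hj => ?_
  rw [hF.1] at hi
  rw [hF.2.1] at hj
  have hv : (i + 1, j + 1) ∈ projGridVertices m n := ⟨by simp, hi, by simp, hj⟩
  have e := h hv
  rw [HBBL_label hF.ne_nil oF (by rwa [hF.1]) (by rwa [hF.2.1]),
    HBBL_label hG.ne_nil oG (by rwa [hG.1]) (by rwa [hG.2.1])] at e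
  rw [hF.1, hF.2.1] at iF
  rw [hG.1, hG.2.1] at iG
  exact alternatingValue_injOn (m * n) (iF.lt_mul hi hj) (iG.lt_mul hi hj)
    (by push_cast; exact e)

theorem mainTheorem1 (m n : ℕ) (hm : 3 ≤ m) (hn : 3 ≤ n) (hm_odd : Odd m) (hn_odd : Odd n) :
    (∀ F : List (ℕ × ℕ), IsProjFactorizationSeq m n F →
      IsStandardBicentrallyBalanced m n (HBBL m n F)) ∧
    (∀ F' : List (ℕ × ℕ), IsProjFactorizationSeq n m F' →
      IsStandardBicentrallyBalanced m n (VBBL m n F')) ∧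
    (∀ F₁ F₂ : List (ℕ × ℕ), IsProjFactorizationSeq m n F₁ → IsProjFactorizationSeq m n F₂ →
      F₁ ≠ F₂ → ¬ Set.EqOn (HBBL m n F₁).label (HBBL m n F₂).label (projGridVertices m n)) ∧
    (∀ F'₁ F'₂ : List (ℕ × ℕ), IsProjFactorizationSeq n m F'₁ → IsProjFactorizationSeq n m F'₂ →
      F'₁ ≠ F'₂ →
        ¬ Set.EqOn (VBBL m n F'₁).label (VBBL m n F'₂).label (projGridVertices m n)) := by
  refine ⟨fun F hF => ?_, fun F hF => ?_, fun F G hF hG hne h => ?_, fun F G hF hG hne h => ?_⟩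
  · have h := isGridIndex_mixedRadixIndex (hF.odd hm_odd hn_odd)
    have hd := HBBL_width_height m n F hF.ne_nil
    rw [hF.1, hF.2.1] at h hd
    refine h.isStandardBicentrallyBalanced hm_odd hn_odd hd.1 hd.2 fun i j hi hj => ?_
    rw [HBBL_label hF.ne_nil (hF.odd hm_odd hn_odd) (by rwa [hF.1]) (by rwa [hF.2.1]),
      Nat.cast_mul]
  · have h := isGridIndex_mixedRadixIndex (hF.odd hn_odd hm_odd)
    have hd := HBBL_width_height n m F hF.ne_nil
    rw [hF.1, hF.2.1] at h hd
    rw [VBBL_eq_transpose]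
    refine h.swap.isStandardBicentrallyBalanced hm_odd hn_odd hd.2 hd.1 fun i j hi hj => ?_
    refine (HBBL_label hF.ne_nil (hF.odd hn_odd hm_odd) (by rwa [hF.1])
      (by rwa [hF.2.1])).trans ?_
    rw [Nat.cast_mul, mul_comm]
  · exact hne (hF.eq_of_eqOn hm_odd hn_odd hG h)
  · refine hne (hF.eq_of_eqOn hn_odd hm_odd hG fun v hv => ?_)
    have := h (x := v.swap) ⟨hv.2.2.1, hv.2.2.2, hv.1, hv.2.1⟩
    rwa [VBBL_eq_transpose, VBBL_eq_transpose] at this
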